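/- Let $b>0$ and $X=[0,b)$. An interval exchange transformation (IET) of $X$ is a right continuous bijection $f\colon X\to X$ with finitely many discontinuities which is a local translation at each of its continuity points. Let $f$ be an IET of $X$ that is ergodic with respect to Lebesgue measure $\lambda$. For $0<t<b$ let $f_t\colon[0,t)\to[0,t)$ be the first return map of $f$ to $[0,t)$, that is, $f_t(x)=f^{n(x)}(x)$ with $n(x)=\min\{n\ge 1: f^n(x)\in[0,t)\}$. Let $$X_{\mathrm{wm}}=\{0<t<b \mid f_t \text{ is weakly mixing relative to } \lambda|_{[0,t)}\},$$ where a map $T$ preserving a finite measure $\mu$ is weakly mixing if every measurable $F$ with values in $\mathbb C$ and $F\circ T=\theta F$ $\mu$-almost everywhere for some $\theta\in\mathbb C$ is constant $\mu$-almost everywhere. Then $X_{\mathrm{wm}}$ is a residual subset of $X$ (its complement in $X$ is meager) and has full Lebesgue measure: $\lambda(X\setminus X_{\mathrm{wm}})=0$, so $\lambda(X_{\mathrm{wm}})=b$. -/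

import Mathlib

open MeasureTheory Filter Topology Set

/-- An interval exchange transformation of `X = [0, b)`: a right continuous bijection of `X` with
finitely many discontinuities which is a local translation at each of its continuity points.
All topological notions are those of the subspace `[0, b)`. -/
structure IsIET {b : ℝ} (f : Ico (0 : ℝ) b → Ico (0 : ℝ) b) : Prop where
  bijective : Function.Bijective f
  right_continuous : ∀ x, ContinuousWithinAt f (Ici x) x
  finite_discontinuities : {x | ¬ ContinuousAt f x}.Finite
  local_translation : ∀ x, ContinuousAt f x →
    ∀ᶠ y in 𝓝 x, (f y : ℝ) - (y : ℝ) = (f x : ℝ) - (x : ℝ)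

/-- The first return time `min {n ≥ 1 | f^n x ∈ A}` (with value `0` if the forward orbit of `x`
never meets `A`; for an interval exchange transformation `f` of `[0, b)`, `A = [0, t)` and
`x ∈ A` this does not happen). -/
noncomputable def firstReturnTime {α : Type*} (f : α → α) (A : Set α) (x : α) : ℕ :=
  sInf {n : ℕ | 1 ≤ n ∧ f^[n] x ∈ A}

theorem iterate_firstReturnTime_mem {α : Type*} (f : α → α) (A : Set α) {x : α} (hx : x ∈ A) :
    f^[firstReturnTime f A x] x ∈ A := by
  rcases Set.eq_empty_or_nonempty {n : ℕ | 1 ≤ n ∧ f^[n] x ∈ A} with h | h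
  · have h0 : firstReturnTime f A x = 0 := by rw [firstReturnTime, h, Nat.sInf_empty]
    rw [h0]
    exact hx
  · exact (Nat.sInf_mem h).2

/-- The map induced by `f` on `A` (first return map). -/
noncomputable def inducedMap {α : Type*} (f : α → α) (A : Set α) : A → A :=
  fun x => ⟨f^[firstReturnTime f A x] x, iterate_firstReturnTime_mem f A x.2⟩

/-- A map `T` is weakly mixing relative to the finite measure `μ` if it preserves `μ` and all its
measurable eigenfunctions, for all eigenvalues `θ ∈ ℂ`, are constant almost everywhere (the
eigenvalue `θ = 1` gives ergodicity, so the only eigenvalue is `1` and it is simple). -/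
structure WeaklyMixing {α : Type*} [MeasurableSpace α] (T : α → α) (μ : Measure α) : Prop where
  measurePreserving : MeasurePreserving T μ μ
  eigenfunction_const : ∀ (θ : ℂ) (F : α → ℂ), Measurable F →
    (∀ᵐ x ∂μ, F (T x) = θ * F x) → ∃ c : ℂ, ∀ᵐ x ∂μ, F x = c

/-- The subinterval `[0, t)` of `X = [0, b)`. -/
def initialInterval {b : ℝ} (t : Ico (0 : ℝ) b) : Set (Ico (0 : ℝ) b) :=
  {x | (x : ℝ) < (t : ℝ)}

/-- Lebesgue measure on `X = [0, b)`. -/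
noncomputable def lebesgueIco (b : ℝ) : Measure (Ico (0 : ℝ) b) :=
  Measure.comap Subtype.val volume

/-- The set of `0 < t < b` such that the map induced by `f` on `[0, t)` is weakly mixing relative
to Lebesgue measure, as a subset of `X = [0, b)`. -/
def weakMixingSet {b : ℝ} (f : Ico (0 : ℝ) b → Ico (0 : ℝ) b) : Set (Ico (0 : ℝ) b) :=
  {t | 0 < (t : ℝ) ∧
    WeaklyMixing (inducedMap f (initialInterval t)) (Measure.comap Subtype.val (lebesgueIco b))}

/-!
An eigenfunction `F` of the first return map to `A = [0, t)` with eigenvalue `θ` extends, by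
following orbits up to their first entrance into `A`, to a function `G` on `[0, b)` with
`G ∘ f = θ ^ 1_A * G` almost everywhere (`returnExtension_comp_ae`). If `θ = 1`, then `G` is constant
by ergodicity of `f`. To exclude `θ ≠ 1` it is enough to find times `r` at which `f^r` is close to
the identity on two sets of measure bounded below, such that the orbit segments of length `r` visit
`A` exactly `N + 1` times when they start in one set and `N` times when they start in the other
(`HasSplitReturns`): since `G` is nearly continuous, `θ ^ (N + 1)` and `θ ^ N` are both close to `1`,
and so is `θ` (`eq_one_of_hasSplitReturns`).

Such returns come from towers. The first return map to an interval `J` is a translation on each of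
at most `M` intervals, with `M` independent of `J`: the points which separate them are determined by
the discontinuity of `f` or the endpoint of `J` that they hit (`IsIET.finite_singularSet`). The towers
over these intervals fill the space, so one of them, with base `J₁` and height `h`, has measure at
least `b / M` (`IsIET.exists_large_returnTower`). Applying the same to `J₁` gives `J₂ ⊆ J₁` of
comparable length which returns to `J₁` at a time `r`. At time `r` each of the lower `h` levels over
`J₂` moves by less than the length of `J₁`. If `t` lies in the middle third of a level in the upper
half of the tower over `J₂`, then the points in the lower half over the left third of `J₂` visit
`[0, t)` exactly once more until time `r` than those over the right third
(`IsNestedTower.hasSplitReturns`).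

The set `E` of these `t` is open, has measure bounded below, and is invariant under `f` up to one
level, which is as short as we please. Letting the length of `J` go to `0` along a summable sequence,
the upper limit of the sets `E` is invariant up to a null set by Borel–Cantelli, hence of full measure
by ergodicity. It is a countable intersection of open sets of full measure, which are dense, so it is
residual as well.
-/

/-! ### First return maps of measure preserving maps -/

section FirstReturn

variable {α : Type*} {f : α → α} {A : Set α}

theorem firstReturnTime_eq_iff {x : α} {n : ℕ} (hn : 1 ≤ n) :
    firstReturnTime f A x = n ↔ f^[n] x ∈ A ∧ ∀ i, 1 ≤ i → i < n → f^[i] x ∉ A := by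
  constructor
  · intro h
    have hne : {n : ℕ | 1 ≤ n ∧ f^[n] x ∈ A}.Nonempty := by
      rw [Set.nonempty_iff_ne_empty]
      intro h0
      rw [firstReturnTime, h0, Nat.sInf_empty] at h
      omega
    have h1 := Nat.sInf_mem hne
    change 1 ≤ firstReturnTime f A x ∧ f^[firstReturnTime f A x] x ∈ A at h1
    rw [h] at h1
    refine ⟨h1.2, fun i hi hin hiA => ?_⟩
    have : firstReturnTime f A x ≤ i := Nat.sInf_le ⟨hi, hiA⟩
    omega
  · rintro ⟨h1, h2⟩
    refine le_antisymm (Nat.sInf_le ⟨hn, h1⟩) (le_csInf ⟨n, hn, h1⟩ ?_)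
    rintro i ⟨hi, hiA⟩
    by_contra hlt
    exact h2 i hi (not_le.1 hlt) hiA

theorem firstReturnTime_eq_zero {x : α} (h : ∀ n, 1 ≤ n → f^[n] x ∉ A) :
    firstReturnTime f A x = 0 := by
  have h0 : {n : ℕ | 1 ≤ n ∧ f^[n] x ∈ A} = ∅ := by
    ext n
    simpa using h n
  rw [firstReturnTime, h0, Nat.sInf_empty]

theorem firstReturnTime_spec {x : α} (h : ∃ n, 1 ≤ n ∧ f^[n] x ∈ A) :
    1 ≤ firstReturnTime f A x ∧ f^[firstReturnTime f A x] x ∈ A :=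
  Nat.sInf_mem (s := {n : ℕ | 1 ≤ n ∧ f^[n] x ∈ A}) h

/-- The point at which the forward orbit of `x` first meets `A` at a time `≥ 1`; it is `x` itself
if this never happens. -/
noncomputable def firstReturnPoint (f : α → α) (A : Set α) (x : α) : α :=
  f^[firstReturnTime f A x] x

theorem firstReturnPoint_of_apply_mem {x : α} (h : f x ∈ A) : firstReturnPoint f A x = f x := by
  have : firstReturnTime f A x = 1 :=
    (firstReturnTime_eq_iff le_rfl).2 ⟨h, fun i h1 h2 => by omega⟩
  rw [firstReturnPoint, this, Function.iterate_one]

theorem firstReturnPoint_apply {x : α} (h : f x ∉ A) (hx : ∃ n, 1 ≤ n ∧ f^[n] x ∈ A) :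
    firstReturnPoint f A (f x) = firstReturnPoint f A x := by
  obtain ⟨h1, h2⟩ := firstReturnTime_spec hx
  obtain ⟨n, hn⟩ : ∃ n, firstReturnTime f A x = n + 1 := ⟨_, (Nat.sub_add_cancel h1).symm⟩
  have hr := (firstReturnTime_eq_iff (f := f) (A := A) (x := x) (n := n + 1) (by omega)).1 hn
  have hn1 : 1 ≤ n := by
    by_contra h0
    obtain rfl : n = 0 := by omega
    exact h hr.1
  have : firstReturnTime f A (f x) = n := by
    refine (firstReturnTime_eq_iff hn1).2 ⟨hr.1, fun i hi hin => ?_⟩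
    exact hr.2 (i + 1) (by omega) (by omega)
  rw [firstReturnPoint, firstReturnPoint, this, hn, Function.iterate_succ_apply]

/-- Extension of a function on `A` to the whole space, constant along orbit segments outside `A`:
a point outside `A` gets the value at its first entrance to `A`. Points which never enter `A` get
the value `0`. -/
noncomputable def returnExtension (f : α → α) (A : Set α) (F : A → ℂ) (x : α) : ℂ :=
  open Classical in
  if x ∈ A then Function.extend Subtype.val F 0 x
  else Function.extend Subtype.val F 0 (firstReturnPoint f A x)

theorem returnExtension_coe (F : A → ℂ) (x : A) : returnExtension f A F x = F x := by
  rw [returnExtension, if_pos x.2]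
  exact Subtype.val_injective.extend_apply F 0 x

theorem returnExtension_apply (F : A → ℂ) {x : α} (hx : ∃ n, 1 ≤ n ∧ f^[n] x ∈ A) :
    returnExtension f A F (f x) = Function.extend Subtype.val F 0 (firstReturnPoint f A x) := by
  by_cases h : f x ∈ A
  · rw [returnExtension, if_pos h, firstReturnPoint_of_apply_mem h]
  · rw [returnExtension, if_neg h, firstReturnPoint_apply h hx]

theorem returnExtension_apply_of_notMem (F : A → ℂ) {x : α} (hxA : x ∉ A) :
    returnExtension f A F (f x) = returnExtension f A F x := by
  by_cases hx : ∃ n, 1 ≤ n ∧ f^[n] x ∈ A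
  · rw [returnExtension_apply F hx, returnExtension, if_neg hxA]
  · push Not at hx
    have h0 : ∀ y : α, y ∉ A → Function.extend (Subtype.val : A → α) F 0 y = 0 := by
      intro y hy
      rw [Function.extend_apply' _ _ _ (by rintro ⟨a, rfl⟩; exact hy a.2)]
      rfl
    have hfx : f x ∉ A := hx 1 le_rfl
    have hr : firstReturnPoint f A x = x := by
      rw [firstReturnPoint, firstReturnTime_eq_zero hx]; rfl
    have hr' : firstReturnPoint f A (f x) = f x := by
      rw [firstReturnPoint, firstReturnTime_eq_zero fun n hn => hx (n + 1) (by omega)]; rfl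
    rw [returnExtension, returnExtension, if_neg hxA, if_neg hfx, hr, hr', h0 _ hxA, h0 _ hfx]

variable [MeasurableSpace α]

theorem measurable_firstReturnTime (hf : Measurable f) (hA : MeasurableSet A) :
    Measurable (firstReturnTime f A) := by
  have key : ∀ n, 1 ≤ n → MeasurableSet (firstReturnTime f A ⁻¹' {n}) := by
    intro n hn
    have : firstReturnTime f A ⁻¹' {n} =
        f^[n] ⁻¹' A ∩ ⋂ i, ⋂ (_ : 1 ≤ i), ⋂ (_ : i < n), (f^[i] ⁻¹' A)ᶜ := by
      ext x
      simp [firstReturnTime_eq_iff hn]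
    rw [this]
    exact ((hf.iterate n) hA).inter (MeasurableSet.iInter fun i => MeasurableSet.iInter fun _ =>
      MeasurableSet.iInter fun _ => ((hf.iterate i) hA).compl)
  refine measurable_to_countable' fun n => ?_
  rcases Nat.eq_zero_or_pos n with rfl | hn
  · have : firstReturnTime f A ⁻¹' {0} = (⋃ n, firstReturnTime f A ⁻¹' {n + 1})ᶜ := by
      ext x
      simp only [mem_preimage, mem_singleton_iff, mem_compl_iff, mem_iUnion, not_exists]
      exact ⟨fun h n => by omega, fun h => by
        by_contra h0
        exact h _ (Nat.sub_add_cancel (Nat.pos_of_ne_zero h0)).symm⟩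
    rw [this]
    exact (MeasurableSet.iUnion fun n => key _ (by omega)).compl
  · exact key n hn

theorem measurable_firstReturnPoint (hf : Measurable f) (hA : MeasurableSet A) :
    Measurable (firstReturnPoint f A) := by
  have h : Measurable fun p : ℕ × α => f^[p.1] p.2 :=
    measurable_from_prod_countable_right fun n => hf.iterate n
  exact h.comp ((measurable_firstReturnTime hf hA).prodMk measurable_id)

variable {μ : Measure α}

theorem ae_of_ae_comap_subtype (hA : MeasurableSet A) {p : α → Prop}
    (h : ∀ᵐ x : A ∂(μ.comap (Subtype.val : A → α)), p x) : ∀ᵐ x ∂μ, x ∈ A → p x := by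
  rw [ae_iff, (MeasurableEmbedding.subtype_coe hA).comap_apply] at h
  rw [ae_iff]
  refine measure_mono_null ?_ h
  intro x hx
  rw [mem_ofPred_eq, Classical.not_imp] at hx
  exact ⟨⟨x, hx.1⟩, hx.2, rfl⟩

theorem ae_comap_subtype_of_ae (hA : MeasurableSet A) {p : α → Prop}
    (h : ∀ᵐ x ∂μ, p x) : ∀ᵐ x : A ∂(μ.comap (Subtype.val : A → α)), p x := by
  rw [ae_iff] at h
  rw [ae_iff, (MeasurableEmbedding.subtype_coe hA).comap_apply]
  refine measure_mono_null ?_ h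
  rintro _ ⟨x, hx, rfl⟩
  exact hx

variable [IsFiniteMeasure μ]

theorem ae_exists_iterate_mem (hf : MeasurePreserving f μ μ) (hA : MeasurableSet A) :
    ∀ᵐ x ∂μ, x ∈ A → ∃ n, 1 ≤ n ∧ f^[n] x ∈ A := by
  filter_upwards [hf.conservative.ae_mem_imp_frequently_image_mem hA.nullMeasurableSet] with x hx hxA
  obtain ⟨n, hn, h⟩ := frequently_atTop.1 (hx hxA) 1
  exact ⟨n, hn, h⟩

/-- Decomposing `S` by the time elapsed since the last visit to `A`, the set of points of `A`
which first return into `S` is no larger than `S`. -/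
theorem measure_firstReturnPoint_preimage_le (hf : MeasurePreserving f μ μ) (hA : MeasurableSet A)
    {S : Set α} (hS : MeasurableSet S) :
    μ (A ∩ firstReturnPoint f A ⁻¹' S) ≤ μ S := by
  -- `V n` consists of the points reaching `S` at time `n` without having met `A` before
  let V : ℕ → Set α := fun n => {x | (∀ i < n, f^[i] x ∉ A) ∧ f^[n] x ∈ S}
  let U : ℕ → Set α := fun n => A ∩ f ⁻¹' (V n)
  have hVm : ∀ n, MeasurableSet (V n) := by
    intro n
    have : V n = (⋂ i, ⋂ (_ : i < n), (f^[i] ⁻¹' A)ᶜ) ∩ f^[n] ⁻¹' S := by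
      ext x
      simp [V]
    rw [this]
    exact (MeasurableSet.iInter fun i => MeasurableSet.iInter fun _ =>
      ((hf.measurable.iterate i) hA).compl).inter ((hf.measurable.iterate n) hS)
  have hstep : ∀ n, μ (V n) = μ (U n) + μ (V (n + 1)) := by
    intro n
    rw [← hf.measure_preimage (hVm n).nullMeasurableSet,
      ← measure_inter_add_sdiff (f ⁻¹' V n) hA, inter_comm]
    congr 2
    ext x
    simp only [Set.mem_sdiff, V, mem_ofPred_eq, mem_preimage]
    constructor
    · rintro ⟨⟨h1, h2⟩, h3⟩
      refine ⟨fun i hi => ?_, h2⟩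
      rcases i with _ | i
      · exact h3
      · exact h1 i (by omega)
    · rintro ⟨h1, h2⟩
      exact ⟨⟨fun i hi => h1 (i + 1) (by omega), h2⟩, h1 0 (by omega)⟩
  have hsum : ∀ n, ∑ i ∈ Finset.range n, μ (U i) + μ (V n) = μ S := by
    intro n
    induction n with
    | zero => simp [V]
    | succ n ih => rw [Finset.sum_range_succ, add_assoc, ← hstep n, ih]
  have hcover : μ (A ∩ firstReturnPoint f A ⁻¹' S) ≤ μ (⋃ n, U n) := by
    refine measure_mono_ae ?_
    filter_upwards [ae_exists_iterate_mem hf hA] with x hx hxS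
    obtain ⟨hxA, hxS⟩ := hxS
    obtain ⟨h1, -⟩ := firstReturnTime_spec (hx hxA)
    obtain ⟨n, hn⟩ : ∃ n, firstReturnTime f A x = n + 1 := ⟨_, (Nat.sub_add_cancel h1).symm⟩
    have hr := (firstReturnTime_eq_iff (f := f) (A := A) (x := x) (n := n + 1) (by omega)).1 hn
    refine mem_iUnion.2 ⟨n, hxA, fun i hi => hr.2 (i + 1) (by omega) (by omega), ?_⟩
    simpa [firstReturnPoint, hn] using hxS
  refine hcover.trans ((measure_iUnion_le _).trans ?_)
  rw [ENNReal.tsum_eq_iSup_nat]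
  exact iSup_le fun n => (le_self_add.trans (hsum n).le)

theorem measurable_inducedMap (hf : Measurable f) (hA : MeasurableSet A) :
    Measurable (inducedMap f A) :=
  ((measurable_firstReturnPoint hf hA).comp measurable_subtype_coe).subtype_mk

theorem isFiniteMeasure_comap_subtype (hA : MeasurableSet A) :
    IsFiniteMeasure (μ.comap (Subtype.val : A → α)) := by
  constructor
  rw [(MeasurableEmbedding.subtype_coe hA).comap_apply]
  exact measure_lt_top _ _

/-- The first return map of a finite measure preserving map preserves the restricted measure. It
suffices to know that preimages do not gain measure, as the total mass is finite. -/
theorem measurePreserving_inducedMap (hf : MeasurePreserving f μ μ) (hA : MeasurableSet A) :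
    MeasurePreserving (inducedMap f A) (μ.comap Subtype.val) (μ.comap Subtype.val) := by
  have hm := measurable_inducedMap hf.measurable hA
  have hemb := MeasurableEmbedding.subtype_coe hA
  have := isFiniteMeasure_comap_subtype (μ := μ) hA
  refine ⟨hm, Measure.eq_of_le_of_measure_univ_eq (Measure.le_iff.2 fun s hs => ?_) ?_⟩
  · rw [Measure.map_apply hm hs, hemb.comap_apply, hemb.comap_apply]
    refine le_trans (measure_mono ?_) (measure_firstReturnPoint_preimage_le hf hA
      (hemb.measurableSet_image.2 hs))
    rintro _ ⟨x, hx, rfl⟩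
    exact ⟨x.2, _, hx, rfl⟩
  · rw [Measure.map_apply hm MeasurableSet.univ, preimage_univ]

theorem measurable_returnExtension (hf : Measurable f) (hA : MeasurableSet A) {F : A → ℂ}
    (hF : Measurable F) : Measurable (returnExtension f A F) := by
  have hE : Measurable (Function.extend (Subtype.val : A → α) F 0) :=
    (MeasurableEmbedding.subtype_coe hA).measurable_extend hF measurable_zero
  exact Measurable.ite hA hE (hE.comp (measurable_firstReturnPoint hf hA))

/-- An eigenfunction of the first return map extends to a solution of the multiplicative cohomology
equation `G ∘ f = θ ^ 1_A * G` over the whole system. -/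
theorem returnExtension_comp_ae (hf : MeasurePreserving f μ μ) (hA : MeasurableSet A) {F : A → ℂ}
    {θ : ℂ} (hF : ∀ᵐ x : A ∂(μ.comap (Subtype.val : A → α)), F (inducedMap f A x) = θ * F x) :
    ∀ᵐ x ∂μ, returnExtension f A F (f x) =
      θ ^ (A.indicator (1 : α → ℕ) x) * returnExtension f A F x := by
  have h' : ∀ᵐ x : A ∂(μ.comap (Subtype.val : A → α)),
      Function.extend Subtype.val F 0 (firstReturnPoint f A x) =
        θ * returnExtension f A F x := by
    filter_upwards [hF] with x hx
    rw [returnExtension_coe, ← hx]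
    exact Subtype.val_injective.extend_apply F 0 (inducedMap f A x)
  filter_upwards [ae_exists_iterate_mem hf hA, ae_of_ae_comap_subtype hA
    (p := fun x => Function.extend Subtype.val F 0 (firstReturnPoint f A x) =
      θ * returnExtension f A F x) h'] with x h1 h2
  by_cases hx : x ∈ A
  · rw [returnExtension_apply F (h1 hx), h2 hx, indicator_of_mem hx, Pi.one_apply, pow_one]
  · rw [returnExtension_apply_of_notMem F hx, indicator_of_notMem hx, pow_zero, one_mul]

end FirstReturn

/-! ### A criterion for the absence of eigenfunctions -/

section Criterion

variable {X : Type*} [MeasurableSpace X] {μ : Measure X} {f : X → X}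

theorem ae_iterate_eq_pow_mul (hf : MeasurePreserving f μ μ) {A : Set X} {θ : ℂ} {G : X → ℂ}
    (hG : ∀ᵐ x ∂μ, G (f x) = θ ^ (A.indicator (1 : X → ℕ) x) * G x) (r : ℕ) :
    ∀ᵐ x ∂μ, G (f^[r] x) = θ ^ (birkhoffSum f (A.indicator (1 : X → ℕ)) r x) * G x := by
  induction r with
  | zero => simp
  | succ r ih =>
    filter_upwards [ih, (hf.iterate r).quasiMeasurePreserving.ae hG] with x h1 h2
    rw [Function.iterate_succ_apply', h2, h1, birkhoffSum_succ, pow_add]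
    ring

variable [IsFiniteMeasure μ]

theorem exists_measure_lt_of_iInter_eq_empty {s : ℕ → Set X} (hs : ∀ n, MeasurableSet (s n))
    (hanti : Antitone s) (hempty : ⋂ n, s n = ∅) {κ : ENNReal} (hκ : 0 < κ) :
    ∃ n, μ (s n) < κ := by
  have h := tendsto_measure_iInter_atTop (μ := μ) (fun n => (hs n).nullMeasurableSet) hanti
    ⟨0, measure_ne_top _ _⟩
  rw [hempty, measure_empty] at h
  exact (h.eventually_lt_const hκ).exists

variable [MetricSpace X] [BorelSpace X]

/-- A measurable function is uniformly continuous, up to an error `η`, off a set of small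
measure. -/
theorem exists_small_set_dist_lt {G : X → ℂ} (hG : Measurable G) {η : ℝ} (hη : 0 < η)
    {κ : ENNReal} (hκ : 0 < κ) :
    ∃ δ : ℝ, 0 < δ ∧ ∃ Z : Set X, MeasurableSet Z ∧ μ Z < κ ∧
      ∀ x ∉ Z, ∀ y ∉ Z, dist x y < δ → dist (G x) (G y) < η := by
  have hκ3 : 0 < κ / 3 := ENNReal.div_pos hκ.ne' (by simp)
  -- truncation of `G` to make it integrable
  obtain ⟨M, hM⟩ : ∃ M : ℕ, μ {x | (M : ℝ) ≤ ‖G x‖} < κ / 3 := by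
    refine exists_measure_lt_of_iInter_eq_empty
      (fun n => measurableSet_le measurable_const hG.norm) ?_ ?_ hκ3
    · intro m n hmn x (hx : (n : ℝ) ≤ ‖G x‖)
      exact le_trans (Nat.cast_le.2 hmn) hx
    · ext x
      obtain ⟨n, hn⟩ := exists_nat_gt ‖G x‖
      simp only [mem_iInter, mem_ofPred_eq, mem_empty_iff_false, iff_false, not_forall, not_le]
      exact ⟨n, hn⟩
  set Z₁ : Set X := {x | (M : ℝ) ≤ ‖G x‖}
  have hZ₁ : MeasurableSet Z₁ := measurableSet_le measurable_const hG.norm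
  have hint : Integrable (Z₁ᶜ.indicator G) μ := by
    refine Integrable.of_bound (hG.indicator hZ₁.compl).aestronglyMeasurable (M : ℝ)
      (Eventually.of_forall fun x => ?_)
    by_cases hx : x ∈ Z₁
    · simp [hx]
    · rw [indicator_of_mem (by exact hx)]
      exact (not_le.1 hx).le
  -- approximation by a continuous function in measure
  have hη3 : ENNReal.ofReal (η / 3) ≠ 0 := by simpa using hη
  obtain ⟨κ', hκ'0, hκ'⟩ := exists_between hκ3
  obtain ⟨g, hg, -⟩ := hint.exists_boundedContinuous_lintegral_sub_le (μ := μ)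
    (ε := κ' * ENNReal.ofReal (η / 3)) (mul_ne_zero hκ'0.ne' hη3)
  set Z₂ : Set X := {x | ENNReal.ofReal (η / 3) ≤ ‖Z₁ᶜ.indicator G x - g x‖ₑ}
  have hm2 : Measurable fun x => ‖Z₁ᶜ.indicator G x - g x‖ₑ :=
    ((hG.indicator hZ₁.compl).sub g.continuous.measurable).enorm
  have hZ₂ : MeasurableSet Z₂ := measurableSet_le measurable_const hm2
  have hμZ₂ : μ Z₂ < κ / 3 := by
    refine lt_of_le_of_lt ?_ hκ'
    refine (meas_ge_le_lintegral_div hm2.aemeasurable hη3 ENNReal.ofReal_ne_top).trans ?_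
    exact ENNReal.div_le_of_le_mul hg
  -- points near which the continuous function oscillates too much
  let Z₃ : ℕ → Set X := fun n => {x | ∃ y, dist x y < 1 / (n + 1 : ℝ) ∧ η / 3 < dist (g x) (g y)}
  have hopen : ∀ n, IsOpen (Z₃ n) := by
    intro n
    have : Z₃ n = ⋃ y, {x | dist x y < 1 / (n + 1 : ℝ)} ∩ {x | η / 3 < dist (g x) (g y)} := by
      ext x
      simp [Z₃]
    rw [this]
    refine isOpen_iUnion fun y => IsOpen.inter ?_ ?_
    · exact isOpen_lt (by fun_prop) continuous_const
    · exact isOpen_lt continuous_const (by fun_prop)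
  obtain ⟨n, hn⟩ : ∃ n, μ (Z₃ n) < κ / 3 := by
    refine exists_measure_lt_of_iInter_eq_empty (fun n => (hopen n).measurableSet) ?_ ?_ hκ3
    · rintro m n hmn x ⟨y, hxy, h⟩
      exact ⟨y, hxy.trans_le (one_div_le_one_div_of_le (by positivity) (by gcongr)), h⟩
    · refine eq_empty_of_forall_notMem fun x hx => ?_
      obtain ⟨δ, hδ, h⟩ := Metric.continuous_iff.1 g.continuous x (η / 3) (by positivity)
      obtain ⟨n, hn⟩ := exists_nat_one_div_lt hδ
      obtain ⟨y, hxy, hy⟩ := mem_iInter.1 hx n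
      have := h y (by rw [dist_comm]; exact hxy.trans hn)
      rw [dist_comm] at this
      exact absurd this (not_lt.2 hy.le)
  refine ⟨1 / (n + 1 : ℝ), by positivity, Z₁ ∪ Z₂ ∪ Z₃ n,
    (hZ₁.union hZ₂).union (hopen n).measurableSet, ?_, ?_⟩
  · calc μ (Z₁ ∪ Z₂ ∪ Z₃ n) ≤ μ Z₁ + μ Z₂ + μ (Z₃ n) :=
        (measure_union_le _ _).trans (by gcongr; exact measure_union_le _ _)
      _ < κ / 3 + κ / 3 + κ / 3 := ENNReal.add_lt_add (ENNReal.add_lt_add hM hμZ₂) hn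
      _ = κ := ENNReal.add_thirds κ
  · have happ : ∀ x ∉ Z₁ ∪ Z₂ ∪ Z₃ n, dist (G x) (g x) < η / 3 := by
      intro x hx
      simp only [mem_union, not_or] at hx
      have h2 : ‖Z₁ᶜ.indicator G x - g x‖ₑ < ENNReal.ofReal (η / 3) := not_le.1 hx.1.2
      rw [indicator_of_mem (by exact hx.1.1), ← ofReal_norm,
        ENNReal.ofReal_lt_ofReal_iff (by positivity)] at h2
      rwa [dist_eq_norm]
    intro x hx y hy hxy
    have h3 : dist (g x) (g y) ≤ η / 3 := by
      by_contra h
      exact hx (Or.inr ⟨y, hxy, not_le.1 h⟩)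
    have h4 := happ y hy
    rw [dist_comm] at h4
    linarith [happ x hx, dist_triangle4 (G x) (g x) (g y) (G y)]

/-- At some time `r`, the map `f` is `ε`-close to the identity on two sets of measure at least `κ`,
such that the orbits of length `r` starting in the first of them visit `A` exactly once more than
those starting in the second. -/
def HasSplitReturns (f : X → X) (μ : Measure X) (A : Set X) (κ : ENNReal) (ε : ℝ) : Prop :=
  ∃ (r N : ℕ) (B B' : Set X), κ ≤ μ B ∧ κ ≤ μ B' ∧ (∀ y ∈ B ∪ B', dist (f^[r] y) y < ε) ∧
    (∀ y ∈ B, birkhoffSum f (A.indicator (1 : X → ℕ)) r y = N + 1) ∧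
    ∀ y ∈ B', birkhoffSum f (A.indicator (1 : X → ℕ)) r y = N

/-- If `A` splits arbitrarily close returns, then the cohomology equation `G ∘ f = θ ^ 1_A * G` has
almost everywhere nonzero solutions only for `θ = 1`: close returns with `N` and `N + 1` visits to
`A` force both `θ ^ N` and `θ ^ (N + 1)` to be close to `1`. -/
theorem eq_one_of_hasSplitReturns (hf : MeasurePreserving f μ μ) {A : Set X} {κ : ENNReal}
    (hκ : 0 < κ) (hA : ∀ ε > 0, HasSplitReturns f μ A κ ε) {θ : ℂ} {G : X → ℂ}
    (hGm : Measurable G) (hG0 : ∀ᵐ x ∂μ, G x ≠ 0)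
    (hG : ∀ᵐ x ∂μ, G (f x) = θ ^ (A.indicator (1 : X → ℕ) x) * G x) : θ = 1 := by
  have hκ3 : 0 < κ / 3 := ENNReal.div_pos hκ.ne' (by simp)
  obtain ⟨n, hn⟩ : ∃ n : ℕ, μ {x | ‖G x‖ ≤ 1 / (n + 1 : ℝ) ∧ G x ≠ 0} < κ / 3 := by
    have hne : MeasurableSet {x | G x ≠ 0} := (measurableSet_eq_fun hGm measurable_const).compl
    refine exists_measure_lt_of_iInter_eq_empty
      (fun n => (measurableSet_le hGm.norm measurable_const).inter hne) ?_ ?_ hκ3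
    · rintro m n hmn x ⟨hx, h0⟩
      have hmn' : 1 / (n + 1 : ℝ) ≤ 1 / (m + 1 : ℝ) :=
        one_div_le_one_div_of_le (by positivity) (by gcongr)
      exact ⟨le_trans hx hmn', h0⟩
    · refine eq_empty_of_forall_notMem fun x hx => ?_
      have h0 : G x ≠ 0 := (mem_iInter.1 hx 0).2
      obtain ⟨n, hn⟩ := exists_nat_one_div_lt (norm_pos_iff.2 h0)
      exact absurd hn (not_lt.2 (mem_iInter.1 hx n).1)
  set s : ℝ := 1 / (n + 1 : ℝ)
  have hs : 0 < s := by positivity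
  have key : ∀ η > 0, ∃ N, ‖θ ^ N - 1‖ < η ∧ ‖θ ^ (N + 1) - 1‖ < η := by
    intro η hη
    obtain ⟨δ, hδ, Z, hZ, hμZ, hclose⟩ :=
      exists_small_set_dist_lt (μ := μ) hGm (mul_pos hη hs) hκ3
    obtain ⟨r, N, B, B', hB, hB', hret, hv, hv'⟩ := hA δ hδ
    have aux : ∀ C : Set X, κ ≤ μ C → C ⊆ B ∪ B' → ∃ y ∈ C,
        ‖θ ^ (birkhoffSum f (A.indicator (1 : X → ℕ)) r y) - 1‖ < η := by
      intro C hC hCB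
      have hbad : μ (Z ∪ f^[r] ⁻¹' Z ∪ {x | ‖G x‖ ≤ s ∧ G x ≠ 0}) < μ C := by
        refine lt_of_lt_of_le ?_ hC
        calc _ ≤ μ Z + μ (f^[r] ⁻¹' Z) + μ {x | ‖G x‖ ≤ s ∧ G x ≠ 0} :=
            (measure_union_le _ _).trans (by gcongr; exact measure_union_le _ _)
          _ < κ / 3 + κ / 3 + κ / 3 := by
            refine ENNReal.add_lt_add (ENNReal.add_lt_add hμZ ?_) hn
            rwa [(hf.iterate r).measure_preimage hZ.nullMeasurableSet]
          _ = κ := ENNReal.add_thirds κ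
      obtain ⟨y, ⟨hyC, hybad⟩, hy0, hyr⟩ : ∃ y ∈ C \ (Z ∪ f^[r] ⁻¹' Z ∪ {x | ‖G x‖ ≤ s ∧ G x ≠ 0}),
          G y ≠ 0 ∧ G (f^[r] y) = θ ^ (birkhoffSum f (A.indicator (1 : X → ℕ)) r y) * G y := by
        have h1 : μ (C \ (Z ∪ f^[r] ⁻¹' Z ∪ {x | ‖G x‖ ≤ s ∧ G x ≠ 0})) ≠ 0 := by
          intro h0
          have := measure_le_inter_add_sdiff μ C (Z ∪ f^[r] ⁻¹' Z ∪ {x | ‖G x‖ ≤ s ∧ G x ≠ 0})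
          rw [h0, add_zero] at this
          exact absurd (this.trans (measure_mono inter_subset_right)) (not_le.2 hbad)
        by_contra hcon
        push Not at hcon
        refine h1 (measure_mono_null ?_
          (ae_iff.1 (hG0.and (ae_iterate_eq_pow_mul hf hG r))))
        intro y hy hgood
        exact hcon y hy hgood.1 hgood.2
      simp only [mem_union, not_or, mem_preimage, mem_ofPred_eq, not_and_or, not_le, not_not]
        at hybad
      refine ⟨y, hyC, ?_⟩
      have hGy : s < ‖G y‖ := hybad.2.resolve_right hy0
      have h1 := hclose _ hybad.1.2 _ hybad.1.1 (hret y (hCB hyC))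
      rw [hyr, dist_eq_norm, ← sub_one_mul, norm_mul] at h1
      by_contra hcon
      have := mul_le_mul (not_lt.1 hcon) hGy.le hs.le (norm_nonneg _)
      linarith
    obtain ⟨y, hy, h1⟩ := aux B hB subset_union_left
    obtain ⟨y', hy', h2⟩ := aux B' hB' subset_union_right
    rw [hv y hy] at h1
    rw [hv' y' hy'] at h2
    exact ⟨N, h2, h1⟩
  by_contra hθ
  have hpos : 0 < ‖θ - 1‖ := norm_pos_iff.2 (sub_ne_zero.2 hθ)
  obtain ⟨N, h1, h2⟩ := key (min (1 / 2) (‖θ - 1‖ / 4)) (by positivity)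
  have h3 : 1 / 2 < ‖θ ^ N‖ := by
    have := norm_sub_norm_le 1 (θ ^ N)
    rw [norm_one, norm_sub_rev] at this
    linarith [min_le_left (1 / 2) (‖θ - 1‖ / 4)]
  have h4 : ‖θ ^ N‖ * ‖θ - 1‖ < ‖θ - 1‖ / 2 := by
    rw [← norm_mul, show θ ^ N * (θ - 1) = (θ ^ (N + 1) - 1) - (θ ^ N - 1) by ring]
    linarith [norm_sub_le (θ ^ (N + 1) - 1) (θ ^ N - 1), min_le_right (1 / 2) (‖θ - 1‖ / 4)]
  nlinarith

/-- If `A` splits arbitrarily close returns of the ergodic map `f`, the first return map of `f` to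
`A` is weakly mixing. -/
theorem weaklyMixing_inducedMap_of_hasSplitReturns (hf : Ergodic f μ) {A : Set X}
    (hAm : MeasurableSet A) {κ : ENNReal} (hκ : 0 < κ)
    (hA : ∀ ε > 0, HasSplitReturns f μ A κ ε) :
    WeaklyMixing (inducedMap f A) (μ.comap Subtype.val) := by
  have hT := measurePreserving_inducedMap hf.toMeasurePreserving hAm
  refine ⟨hT, fun θ F hFm hF => ?_⟩
  rcases eq_or_ne θ 0 with rfl | hθ
  · refine ⟨0, ?_⟩
    have h0 : MeasurableSet {x | F x ≠ 0} := (measurableSet_eq_fun hFm measurable_const).compl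
    have h1 : ∀ᵐ x : A ∂(μ.comap Subtype.val), F (inducedMap f A x) = 0 := by
      filter_upwards [hF] with x hx
      rw [hx, zero_mul]
    rw [ae_iff] at h1 ⊢
    rw [← hT.measure_preimage h0.nullMeasurableSet]
    exact h1
  set G := returnExtension f A F with hGdef
  have hGm : Measurable G := measurable_returnExtension hf.measurable hAm hFm
  have hG : ∀ᵐ x ∂μ, G (f x) = θ ^ (A.indicator (1 : X → ℕ) x) * G x :=
    returnExtension_comp_ae hf.toMeasurePreserving hAm hF
  have hrestrict : ∀ c : ℂ, (∀ᵐ x ∂μ, G x = c) → ∃ c : ℂ, ∀ᵐ x : A ∂(μ.comap Subtype.val),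
      F x = c := by
    intro c hc
    refine ⟨c, ?_⟩
    filter_upwards [ae_comap_subtype_of_ae hAm hc] with x hx
    rw [← hx, hGdef, returnExtension_coe]
  have hS : MeasurableSet {x | G x ≠ 0} := (measurableSet_eq_fun hGm measurable_const).compl
  have hinv : f ⁻¹' {x | G x ≠ 0} =ᵐ[μ] {x | G x ≠ 0} := by
    filter_upwards [hG] with x hx
    refine propext ?_
    change G (f x) ≠ 0 ↔ G x ≠ 0
    rw [hx]
    simp [hθ]
  rcases hf.quasiErgodic.ae_empty_or_univ₀ hS.nullMeasurableSet hinv with h | h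
  · refine hrestrict 0 ?_
    rw [ae_eq_empty] at h
    exact h
  · rw [ae_eq_univ] at h
    have hG0 : ∀ᵐ x ∂μ, G x ≠ 0 := h
    have hθ1 : θ = 1 := eq_one_of_hasSplitReturns hf.toMeasurePreserving hκ hA hGm hG0 hG
    subst hθ1
    obtain ⟨c, hc⟩ := hf.ae_eq_const_of_ae_eq_comp_ae hGm.aestronglyMeasurable (g := G) (by
      filter_upwards [hG] with x hx
      rw [Function.comp_apply, hx, one_pow, one_mul])
    exact hrestrict c hc

end Criterion

/-! ### Intervals on which the iterates are translations -/

section Intervals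

/-- The points of `[0, b)` in the open interval `(u, v)`. -/
def seg (b u v : ℝ) : Set (Ico (0 : ℝ) b) := Subtype.val ⁻¹' Ioo u v

/-- `g` acts on the points of `(u, v)` as the translation by `τ`. -/
def TranslatesOn {b : ℝ} (g : Ico (0 : ℝ) b → Ico (0 : ℝ) b) (u v τ : ℝ) : Prop :=
  ∀ x ∈ seg b u v, (g x : ℝ) = x + τ

variable {b : ℝ} {f : Ico (0 : ℝ) b → Ico (0 : ℝ) b} {u v : ℝ}

theorem mem_seg {x : Ico (0 : ℝ) b} : x ∈ seg b u v ↔ u < x ∧ (x : ℝ) < v := Iff.rfl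

theorem seg_subset_seg {p q : ℝ} (hp : u ≤ p) (hq : q ≤ v) : seg b p q ⊆ seg b u v :=
  preimage_mono (Ioo_subset_Ioo hp hq)

theorem isOpen_seg : IsOpen (seg b u v) := isOpen_Ioo.preimage continuous_subtype_val

theorem measurableSet_seg : MeasurableSet (seg b u v) := isOpen_seg.measurableSet

theorem image_coe_seg (hu : 0 ≤ u) (hv : v ≤ b) : Subtype.val '' seg b u v = Ioo u v := by
  rw [seg, Subtype.image_preimage_coe]
  exact inter_eq_right.2 fun x hx => ⟨hu.trans hx.1.le, hx.2.trans_le hv⟩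

theorem lebesgueIco_apply (s : Set (Ico (0 : ℝ) b)) :
    lebesgueIco b s = volume (Subtype.val '' s) :=
  (MeasurableEmbedding.subtype_coe measurableSet_Ico).comap_apply _ _

theorem lebesgueIco_seg (hu : 0 ≤ u) (hv : v ≤ b) :
    lebesgueIco b (seg b u v) = ENNReal.ofReal (v - u) := by
  rw [lebesgueIco_apply, image_coe_seg hu hv, Real.volume_Ioo]

theorem lebesgueIco_univ : lebesgueIco b univ = ENNReal.ofReal b := by
  rw [lebesgueIco_apply, image_univ, Subtype.range_coe, Real.volume_Ico, sub_zero]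

instance isFiniteMeasure_lebesgueIco : IsFiniteMeasure (lebesgueIco b) :=
  ⟨by rw [lebesgueIco_univ]; exact ENNReal.ofReal_lt_top⟩

theorem seg_nonempty (hu : 0 ≤ u) (huv : u < v) (hv : v ≤ b) : (seg b u v).Nonempty :=
  ⟨⟨(u + v) / 2, by linarith, by linarith⟩, mem_seg.2 ⟨by simp; linarith, by simp; linarith⟩⟩

theorem TranslatesOn.mono {g : Ico (0 : ℝ) b → Ico (0 : ℝ) b} {τ p q : ℝ}
    (h : TranslatesOn g u v τ) (hp : u ≤ p) (hq : q ≤ v) : TranslatesOn g p q τ :=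
  fun x hx => h x (seg_subset_seg hp hq hx)

theorem TranslatesOn.bounds {g : Ico (0 : ℝ) b → Ico (0 : ℝ) b} {τ : ℝ}
    (h : TranslatesOn g u v τ) (hu : 0 ≤ u) (huv : u < v) (hv : v ≤ b) :
    0 ≤ u + τ ∧ v + τ ≤ b := by
  constructor
  · by_contra! hcon
    have h1 : u < min v (-τ) := lt_min huv (by linarith)
    obtain ⟨x, hux, hx⟩ := exists_between h1
    have hxv := hx.trans_le (min_le_left _ _)
    have := h ⟨x, by linarith, by linarith⟩ ⟨hux, hxv⟩
    have h0 := (g ⟨x, by linarith, by linarith⟩).2.1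
    rw [this] at h0
    have h2 := hx.trans_le (min_le_right _ _)
    simp only at h0
    linarith
  · by_contra! hcon
    have h1 : max u (b - τ) < v := max_lt huv (by linarith)
    obtain ⟨x, hx, hxv⟩ := exists_between h1
    have hux := (le_max_left _ _).trans_lt hx
    have := h ⟨x, by linarith, by linarith⟩ ⟨hux, hxv⟩
    have h0 := (g ⟨x, by linarith, by linarith⟩).2.2
    rw [this] at h0
    have h2 := (le_max_right _ _).trans_lt hx
    simp only at h0
    linarith

theorem TranslatesOn.image_seg {g : Ico (0 : ℝ) b → Ico (0 : ℝ) b} {τ : ℝ}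
    (h : TranslatesOn g u v τ) (hu : 0 ≤ u) (hv : v ≤ b) :
    g '' seg b u v = seg b (u + τ) (v + τ) := by
  ext y
  constructor
  · rintro ⟨x, hx, rfl⟩
    rw [mem_seg, h x hx]
    exact ⟨by linarith [hx.1], by linarith [hx.2]⟩
  · rintro ⟨h1, h2⟩
    have hx : (⟨y - τ, by linarith, by linarith⟩ : Ico (0 : ℝ) b) ∈ seg b u v :=
      ⟨by simp only; linarith, by simp only; linarith⟩
    refine ⟨_, hx, Subtype.ext ?_⟩
    rw [h _ hx]
    simp

theorem IsIET.exists_translatesOn (hf : IsIET f) (hu : 0 ≤ u) (huv : u < v) (hv : v ≤ b)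
    (h : ∀ x ∈ seg b u v, ContinuousAt f x) : ∃ τ, TranslatesOn f u v τ := by
  have hpre : IsPreconnected (seg b u v) := by
    rw [← IsInducing.subtypeVal.isPreconnected_image, image_coe_seg hu hv]
    exact isPreconnected_Ioo
  obtain ⟨x₀, hx₀⟩ := seg_nonempty hu huv hv
  refine ⟨(f x₀ : ℝ) - x₀, fun x hx => ?_⟩
  have := hpre.induction₂ (fun x y => (f y : ℝ) - y = (f x : ℝ) - x)
    (fun x hx => (hf.local_translation x (h x hx)).filter_mono nhdsWithin_le_nhds)
    (fun x y z _ _ _ h1 h2 => h2.trans h1) (fun x y _ _ h => h.symm) hx₀ hx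
  linarith

theorem IsIET.exists_translatesOn_iterate (hf : IsIET f) (hu : 0 ≤ u) (huv : u < v) (hv : v ≤ b)
    {n : ℕ} (h : ∀ x ∈ seg b u v, ∀ i < n, ContinuousAt f (f^[i] x)) :
    ∃ τ, TranslatesOn f^[n] u v τ := by
  induction n with
  | zero => exact ⟨0, fun x _ => by simp⟩
  | succ n ih =>
    obtain ⟨τ, hτ⟩ := ih fun x hx i hi => h x hx i (by omega)
    obtain ⟨h0, hb⟩ := hτ.bounds hu huv hv
    obtain ⟨σ, hσ⟩ := hf.exists_translatesOn h0 (by linarith) hb (by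
      rw [← hτ.image_seg hu hv]
      rintro _ ⟨x, hx, rfl⟩
      exact h x hx n (by omega))
    refine ⟨τ + σ, fun x hx => ?_⟩
    rw [Function.iterate_succ_apply', hσ _ (hτ.image_seg hu hv ▸ mem_image_of_mem _ hx), hτ x hx,
      add_assoc]

/-- If `g` translates an interval and `t` is not in its image, the image lies on one side
of `t`. -/
theorem TranslatesOn.lt_iff_lt {g : Ico (0 : ℝ) b → Ico (0 : ℝ) b} {τ : ℝ}
    (h : TranslatesOn g u v τ) {t : Ico (0 : ℝ) b} (ht : t ∉ g '' seg b u v)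
    {x y : Ico (0 : ℝ) b} (hx : x ∈ seg b u v) (hy : y ∈ seg b u v) :
    (g x : ℝ) < t ↔ (g y : ℝ) < t := by
  have key : ∀ x ∈ seg b u v, ∀ y ∈ seg b u v, (g x : ℝ) < t → (g y : ℝ) < t := by
    intro x hx y hy hxt
    by_contra! hty
    have hgx := h x hx
    have hgy := h y hy
    have hz1 : (x : ℝ) < t - τ := by linarith
    have hz2 : (t : ℝ) - τ ≤ y := by linarith
    have hz : (⟨t - τ, x.2.1.trans hz1.le, hz2.trans_lt y.2.2⟩ : Ico (0 : ℝ) b) ∈ seg b u v :=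
      ⟨hx.1.trans hz1, hz2.trans_lt hy.2⟩
    refine ht ⟨_, hz, Subtype.ext ?_⟩
    rw [h _ hz]
    simp
  exact ⟨key x hx y hy, key y hy x hx⟩

/-- Finitely many points cut an open interval into at most one more open intervals. -/
theorem exists_cut_Ioo (s : Finset ℝ) : ∀ {u v : ℝ}, u < v → ∃ 𝓘 : Finset (ℝ × ℝ),
    𝓘.card ≤ s.card + 1 ∧
    (∀ I ∈ 𝓘, u ≤ I.1 ∧ I.1 < I.2 ∧ I.2 ≤ v ∧ ∀ p ∈ s, p ∉ Ioo I.1 I.2) ∧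
    ∀ x ∈ Ioo u v, x ∉ s → ∃ I ∈ 𝓘, x ∈ Ioo I.1 I.2 := by
  induction s using Finset.induction_on_max with
  | empty =>
    intro u v huv
    exact ⟨{(u, v)}, by simp, by simpa using huv, fun x hx _ => ⟨(u, v), by simp, hx⟩⟩
  | insert p s hs ih =>
    intro u v huv
    have hcard : (insert p s).card = s.card + 1 :=
      Finset.card_insert_of_notMem fun hp => lt_irrefl _ (hs p hp)
    rw [hcard]
    by_cases hpu : p ≤ u
    · refine ⟨{(u, v)}, by simp, ?_, fun x hx _ => ⟨(u, v), by simp, hx⟩⟩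
      simp only [Finset.mem_singleton, forall_eq, le_refl, true_and, huv]
      intro q hq hqu
      have : q ≤ p := by
        rcases Finset.mem_insert.1 hq with rfl | hq
        exacts [le_rfl, (hs q hq).le]
      linarith [hqu.1]
    push Not at hpu
    by_cases hpv : v ≤ p
    · obtain ⟨𝓘, h1, h2, h3⟩ := ih huv
      refine ⟨𝓘, by omega, fun I hI => ?_, fun x hx hxs => h3 x hx fun h =>
        hxs (Finset.mem_insert_of_mem h)⟩
      obtain ⟨ha, hb, hc, hd⟩ := h2 I hI
      refine ⟨ha, hb, hc, fun q hq => ?_⟩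
      rcases Finset.mem_insert.1 hq with rfl | hq
      · exact fun h => by linarith [h.2]
      · exact hd q hq
    push Not at hpv
    obtain ⟨𝓘, h1, h2, h3⟩ := ih hpu
    refine ⟨insert (p, v) 𝓘, (Finset.card_insert_le _ _).trans (by omega), fun I hI => ?_, ?_⟩
    · rcases Finset.mem_insert.1 hI with rfl | hI
      · refine ⟨hpu.le, hpv, le_rfl, fun q hq h => ?_⟩
        rcases Finset.mem_insert.1 hq with rfl | hq
        · exact lt_irrefl _ h.1
        · exact lt_asymm h.1 (hs q hq)
      · obtain ⟨ha, hb, hc, hd⟩ := h2 I hI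
        refine ⟨ha, hb, hc.trans hpv.le, fun q hq => ?_⟩
        rcases Finset.mem_insert.1 hq with rfl | hq
        · exact fun h => by linarith [h.2]
        · exact hd q hq
    · intro x hx hxs
      rw [Finset.mem_insert, not_or] at hxs
      rcases lt_or_gt_of_ne hxs.1 with hxp | hxp
      · obtain ⟨I, hI, hxI⟩ := h3 x ⟨hx.1, hxp⟩ hxs.2
        exact ⟨I, Finset.mem_insert_of_mem hI, hxI⟩
      · exact ⟨(p, v), Finset.mem_insert_self _ _, hxp, hx.2⟩

end Intervals

/-! ### Return towers over intervals -/

section Towers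

variable {b : ℝ} {f : Ico (0 : ℝ) b → Ico (0 : ℝ) b} {u v : ℝ}

/-- The interval `(a, c)` is contained in `(u, v)`, all its points first return to `(u, v)` at time
`r`, and up to this time the iterates of `f` are translations on `(a, c)`. -/
structure IsReturnTower (f : Ico (0 : ℝ) b → Ico (0 : ℝ) b) (u v a c : ℝ) (r : ℕ) : Prop where
  left_le : u ≤ a
  lt : a < c
  le_right : c ≤ v
  pos : 0 < r
  translatesOn : ∀ k ≤ r, ∃ τ, TranslatesOn f^[k] a c τ
  mapsTo : MapsTo f^[r] (seg b a c) (seg b u v)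
  notMem : ∀ k, 0 < k → k < r → ∀ x ∈ seg b a c, f^[k] x ∉ seg b u v

/-- Points where the return map to `(u, v)` may fail to be locally a translation: their orbits hit a
discontinuity of `f` or an endpoint of the interval before they return. -/
def singularSet (f : Ico (0 : ℝ) b → Ico (0 : ℝ) b) (u v : ℝ) : Set (Ico (0 : ℝ) b) :=
  {x ∈ seg b u v | ∃ k, f^[k] x ∈ {x | ¬ ContinuousAt f x} ∪ Subtype.val ⁻¹' {u, v} ∧
    ∀ i, 0 < i → i ≤ k → f^[i] x ∉ seg b u v}

/-- Sending a singular point to the discontinuity or endpoint which it hits is injective. -/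
theorem IsIET.finite_singularSet (hf : IsIET f) (u v : ℝ) : (singularSet f u v).Finite ∧
    (singularSet f u v).ncard ≤ {x | ¬ ContinuousAt f x}.ncard + 2 := by
  set P : Set (Ico (0 : ℝ) b) := {x | ¬ ContinuousAt f x} ∪ Subtype.val ⁻¹' {u, v} with hP
  have hfin : (Subtype.val ⁻¹' {u, v} : Set (Ico (0 : ℝ) b)).Finite :=
    (toFinite {u, v}).preimage Subtype.val_injective.injOn
  have hPfin : P.Finite := hf.finite_discontinuities.union hfin
  have hPcard : P.ncard ≤ {x | ¬ ContinuousAt f x}.ncard + 2 := by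
    refine (ncard_union_le _ _).trans (Nat.add_le_add_left ?_ _)
    refine le_trans ?_ ((ncard_insert_le u {v}).trans (by rw [ncard_singleton]))
    exact ncard_le_ncard_of_injOn Subtype.val (fun x hx => hx) Subtype.val_injective.injOn
  choose! k hk hk' using fun (x : Ico (0 : ℝ) b) (hx : x ∈ singularSet f u v) => hx.2
  have hle : ∀ x ∈ singularSet f u v, ∀ y ∈ singularSet f u v,
      f^[k x] x = f^[k y] y → k x ≤ k y → x = y := by
    intro x hx y hy hxy hkxy
    obtain ⟨j, hj⟩ := Nat.exists_eq_add_of_le hkxy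
    rw [hj, Function.iterate_add_apply] at hxy
    have hxj := hf.bijective.injective.iterate _ hxy
    rcases Nat.eq_zero_or_pos j with rfl | hj0
    · exact hxj
    · exact absurd (hxj ▸ hx.1) (hk' y hy j hj0 (by omega))
  have hinj : InjOn (fun x => f^[k x] x) (singularSet f u v) := by
    intro x hx y hy hxy
    rcases le_total (k x) (k y) with h | h
    · exact hle x hx y hy hxy h
    · exact (hle y hy x hx hxy.symm h).symm
  exact ⟨Finite.of_injOn (fun x hx => hk x hx) hinj hPfin,
    (ncard_le_ncard_of_injOn _ (fun x hx => hk x hx) hinj hPfin).trans hPcard⟩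

/-- An interval without singular points is the base of a return tower. -/
theorem IsIET.exists_isReturnTower (hf : IsIET f)
    (hmp : MeasurePreserving f (lebesgueIco b) (lebesgueIco b)) (hu : 0 ≤ u) (hv : v ≤ b)
    {a c : ℝ} (hua : u ≤ a) (hac : a < c) (hcv : c ≤ v)
    (hs : ∀ x ∈ seg b a c, x ∉ singularSet f u v) : ∃ r, IsReturnTower f u v a c r := by
  have hsub : seg b a c ⊆ seg b u v := seg_subset_seg hua hcv
  have hex : ∃ n, 0 < n ∧ ∃ x ∈ seg b a c, f^[n] x ∈ seg b u v := by
    obtain ⟨x, hx, n, hn, hxn⟩ := hmp.conservative.exists_mem_iterate_mem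
      (s := seg b a c) measurableSet_seg.nullMeasurableSet (by
        rw [lebesgueIco_seg (hu.trans hua) (hcv.trans hv)]
        simpa using hac)
    exact ⟨n, Nat.pos_of_ne_zero hn, x, hx, hsub hxn⟩
  classical
  obtain ⟨hr0, x₀, hx₀, hx₀r⟩ := Nat.find_spec hex
  set r := Nat.find hex
  have hnot : ∀ k, 0 < k → k < r → ∀ x ∈ seg b a c, f^[k] x ∉ seg b u v :=
    fun k hk hkr x hx h => Nat.find_min hex hkr ⟨hk, x, hx, h⟩
  have htr : ∀ k ≤ r, ∃ τ, TranslatesOn f^[k] a c τ := by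
    intro k hk
    refine hf.exists_translatesOn_iterate (hu.trans hua) hac (hcv.trans hv) fun x hx i hi => ?_
    by_contra hcont
    exact hs x hx ⟨hsub hx, i, Or.inl hcont, fun j hj hji => hnot j hj (by omega) x hx⟩
  refine ⟨r, hua, hac, hcv, hr0, htr, fun x hx => ?_, hnot⟩
  -- the translate of the base meets `(u, v)`, and it does not contain an endpoint
  obtain ⟨τ, hτ⟩ := htr r le_rfl
  have hend : ∀ y ∈ seg b a c, f^[r] y ∉ seg b u v → (f^[r] y : ℝ) ≠ u ∧ (f^[r] y : ℝ) ≠ v := by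
    intro y hy hy'
    rw [← not_or]
    intro h
    refine hs y hy ⟨hsub hy, r, Or.inr h, fun j hj hjr => ?_⟩
    rcases hjr.eq_or_lt with rfl | hjr
    · exact hy'
    · exact hnot j hj hjr y hy
  have hpt : ∀ p : ℝ, (p = u ∨ p = v) → p - τ ∈ Ioo a c → False := by
    intro p hp hpa
    have hy : (⟨p - τ, by linarith [hpa.1], by linarith [hpa.2]⟩ : Ico (0 : ℝ) b) ∈ seg b a c :=
      hpa
    have hval := hτ _ hy
    simp only [sub_add_cancel] at hval
    have hnm : f^[r] ⟨p - τ, by linarith [hpa.1], by linarith [hpa.2]⟩ ∉ seg b u v := by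
      rw [mem_seg, hval]
      rintro ⟨h1, h2⟩
      rcases hp with rfl | rfl <;> linarith
    obtain ⟨h1, h2⟩ := hend _ hy hnm
    rw [hval] at h1 h2
    exact hp.elim h1 h2
  have hfx := hτ x hx
  have hfx₀ := hτ x₀ hx₀
  rw [mem_seg] at hx hx₀ hx₀r ⊢
  constructor
  · by_contra! h
    exact hpt u (Or.inl rfl) ⟨by linarith, by linarith⟩
  · by_contra! h
    exact hpt v (Or.inr rfl) ⟨by linarith, by linarith⟩

/-- Up to finitely many points, every interval is a union of a bounded number of bases of return
towers. -/
theorem IsIET.exists_returnTowers (hf : IsIET f)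
    (hmp : MeasurePreserving f (lebesgueIco b) (lebesgueIco b)) (hu : 0 ≤ u) (huv : u < v)
    (hv : v ≤ b) : ∃ 𝓘 : Finset (ℝ × ℝ), 𝓘.card ≤ {x | ¬ ContinuousAt f x}.ncard + 3 ∧
      (∀ I ∈ 𝓘, ∃ r, IsReturnTower f u v I.1 I.2 r) ∧
      ∀ᵐ x ∂(lebesgueIco b), x ∈ seg b u v → ∃ I ∈ 𝓘, x ∈ seg b I.1 I.2 := by
  obtain ⟨hfin, hcard⟩ := hf.finite_singularSet u v
  obtain ⟨𝓘, h1, h2, h3⟩ := exists_cut_Ioo (hfin.toFinset.image Subtype.val) huv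
  refine ⟨𝓘, ?_, fun I hI => ?_, ?_⟩
  · have h4 := Finset.card_image_le (s := hfin.toFinset) (f := (Subtype.val : Ico (0 : ℝ) b → ℝ))
    rw [← ncard_eq_toFinset_card _ hfin] at h4
    omega
  · obtain ⟨ha, hb, hc, hd⟩ := h2 I hI
    refine hf.exists_isReturnTower hmp hu hv ha hb hc fun x hx hxs => hd x ?_ hx
    exact Finset.mem_image_of_mem _ (hfin.mem_toFinset.2 hxs)
  · have h0 : lebesgueIco b (singularSet f u v) = 0 := by
      rw [lebesgueIco_apply]
      exact (hfin.image _).measure_zero _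
    filter_upwards [measure_eq_zero_iff_ae_notMem.1 h0] with x hx hxs
    refine h3 x hxs fun h => hx ?_
    obtain ⟨y, hy, hyx⟩ := Finset.mem_image.1 h
    rw [Subtype.ext hyx] at hy
    exact hfin.mem_toFinset.1 hy

theorem exists_le_mul_of_le_sum {ι : Type*} {s : Finset ι} {g : ι → ℝ} {M : ℕ} {L : ℝ}
    (hM : s.card ≤ M) (hL : 0 < L) (h : L ≤ ∑ i ∈ s, g i) : ∃ i ∈ s, L ≤ M * g i := by
  by_contra! hcon
  have hne : s.Nonempty := by
    rw [Finset.nonempty_iff_ne_empty]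
    rintro rfl
    rw [Finset.sum_empty] at h
    linarith
  have h1 : ∑ i ∈ s, M * g i < ∑ _i ∈ s, L := Finset.sum_lt_sum_of_nonempty hne hcon
  rw [← Finset.mul_sum, Finset.sum_const, nsmul_eq_mul] at h1
  have h2 : (M : ℝ) * L ≤ M * ∑ i ∈ s, g i := by gcongr
  have h3 : (s.card : ℝ) * L ≤ M * L := by gcongr
  linarith

theorem IsIET.exists_long_returnTower (hf : IsIET f)
    (hmp : MeasurePreserving f (lebesgueIco b) (lebesgueIco b)) (hu : 0 ≤ u) (huv : u < v)
    (hv : v ≤ b) : ∃ a c r, IsReturnTower f u v a c r ∧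
      v - u ≤ ({x | ¬ ContinuousAt f x}.ncard + 3 : ℕ) * (c - a) := by
  obtain ⟨𝓘, hcard, htow, hcov⟩ := hf.exists_returnTowers hmp hu huv hv
  have hsum : v - u ≤ ∑ I ∈ 𝓘, (I.2 - I.1) := by
    have hnn : ∀ I ∈ 𝓘, 0 ≤ I.2 - I.1 := fun I hI => by
      obtain ⟨r, hr⟩ := htow I hI
      linarith [hr.lt]
    rw [← ENNReal.ofReal_le_ofReal_iff (Finset.sum_nonneg hnn), ← lebesgueIco_seg hu hv,
      ENNReal.ofReal_sum_of_nonneg hnn]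
    calc lebesgueIco b (seg b u v) ≤ lebesgueIco b (⋃ I ∈ 𝓘, seg b I.1 I.2) := by
          refine measure_mono_ae ?_
          filter_upwards [hcov] with x hx hxs
          obtain ⟨I, hI, hxI⟩ := hx hxs
          exact mem_iUnion₂.2 ⟨I, hI, hxI⟩
      _ ≤ ∑ I ∈ 𝓘, lebesgueIco b (seg b I.1 I.2) := measure_biUnion_finset_le _ _
      _ = _ := Finset.sum_congr rfl fun I hI => by
          obtain ⟨r, hr⟩ := htow I hI
          exact lebesgueIco_seg (hu.trans hr.left_le) (hr.le_right.trans hv)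
  obtain ⟨I, hI, h⟩ := exists_le_mul_of_le_sum hcard (by linarith) hsum
  obtain ⟨r, hr⟩ := htow I hI
  exact ⟨I.1, I.2, r, hr, h⟩

/-- By ergodicity the return towers over an interval fill the whole space, so that one of them has
measure bounded below independently of the interval. -/
theorem IsIET.exists_large_returnTower (hf : IsIET f) (herg : Ergodic f (lebesgueIco b))
    (hu : 0 ≤ u) (huv : u < v) (hv : v ≤ b) : ∃ a c r, IsReturnTower f u v a c r ∧
      b ≤ ({x | ¬ ContinuousAt f x}.ncard + 3 : ℕ) * (r * (c - a)) := by
  obtain ⟨𝓘, hcard, htow, hcov⟩ := hf.exists_returnTowers herg.toMeasurePreserving hu huv hv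
  choose! r hr using htow
  have himg : ∀ I ∈ 𝓘, ∀ k < r I, MeasurableSet (f^[k] '' seg b I.1 I.2) ∧
      lebesgueIco b (f^[k] '' seg b I.1 I.2) = ENNReal.ofReal (I.2 - I.1) := by
    intro I hI k hk
    obtain ⟨τ, hτ⟩ := (hr I hI).translatesOn k hk.le
    have ha := hu.trans (hr I hI).left_le
    have hc := (hr I hI).le_right.trans hv
    obtain ⟨h0, hb⟩ := hτ.bounds ha (hr I hI).lt hc
    rw [hτ.image_seg ha hc, lebesgueIco_seg h0 hb]
    exact ⟨measurableSet_seg, by congr 1; ring⟩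
  set W : Set (Ico (0 : ℝ) b) := ⋃ I ∈ 𝓘, ⋃ k ∈ Finset.range (r I), f^[k] '' seg b I.1 I.2 with hW
  have hmemW : ∀ x, x ∈ W ↔ ∃ I ∈ 𝓘, ∃ k < r I, ∃ y ∈ seg b I.1 I.2, f^[k] y = x := by
    intro x
    simp [hW]
  have hWm : MeasurableSet W := Finset.measurableSet_biUnion _ fun I hI =>
    Finset.measurableSet_biUnion _ fun k hk => (himg I hI k (Finset.mem_range.1 hk)).1
  have hsegW : ∀ᵐ x ∂(lebesgueIco b), x ∈ seg b u v → x ∈ W := by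
    filter_upwards [hcov] with x hx hxs
    obtain ⟨I, hI, hxI⟩ := hx hxs
    exact (hmemW x).2 ⟨I, hI, 0, (hr I hI).pos, x, hxI, rfl⟩
  have hinv : W ≤ᵐ[lebesgueIco b] f ⁻¹' W := by
    filter_upwards [herg.quasiMeasurePreserving.ae hsegW] with x hx hxW
    obtain ⟨I, hI, k, hk, y, hy, rfl⟩ := (hmemW x).1 hxW
    change f (f^[k] y) ∈ W
    rcases Nat.lt_or_ge (k + 1) (r I) with hk1 | hk1
    · exact (hmemW _).2 ⟨I, hI, k + 1, hk1, y, hy, Function.iterate_succ_apply' f k y⟩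
    · refine hx ?_
      rw [← Function.iterate_succ_apply' f k y, show k.succ = r I by omega]
      exact (hr I hI).mapsTo hy
  have hWuniv : lebesgueIco b W = ENNReal.ofReal b := by
    rcases herg.ae_empty_or_univ_of_ae_le_preimage hWm.nullMeasurableSet hinv with h | h
    · exfalso
      have h1 : lebesgueIco b (seg b u v) ≤ lebesgueIco b W := measure_mono_ae hsegW
      rw [ae_eq_empty.1 h, lebesgueIco_seg hu hv, nonpos_iff_eq_zero, ENNReal.ofReal_eq_zero] at h1
      linarith
    · rw [measure_congr h, lebesgueIco_univ]
  have hsum : b ≤ ∑ I ∈ 𝓘, (r I * (I.2 - I.1) : ℝ) := by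
    have hnn : ∀ I ∈ 𝓘, 0 ≤ (r I * (I.2 - I.1) : ℝ) := fun I hI =>
      mul_nonneg (Nat.cast_nonneg _) (by linarith [(hr I hI).lt])
    rw [← ENNReal.ofReal_le_ofReal_iff (Finset.sum_nonneg hnn), ← hWuniv,
      ENNReal.ofReal_sum_of_nonneg hnn]
    refine (measure_biUnion_finset_le _ _).trans (Finset.sum_le_sum fun I hI => ?_)
    refine (measure_biUnion_finset_le _ _).trans ?_
    rw [Finset.sum_congr rfl fun k hk => (himg I hI k (Finset.mem_range.1 hk)).2,
      Finset.sum_const, Finset.card_range, nsmul_eq_mul, ENNReal.ofReal_mul (Nat.cast_nonneg _),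
      ENNReal.ofReal_natCast]
  obtain ⟨I, hI, h⟩ := exists_le_mul_of_le_sum hcard (by linarith) hsum
  exact ⟨I.1, I.2, r I, hr I hI, h⟩

end Towers

/-! ### Split returns -/

section NestedTowers

variable {b : ℝ} {f : Ico (0 : ℝ) b → Ico (0 : ℝ) b}

/-- A tower with base `(a, c)` and height `h`, of width less than `ε` and of measure at least
`b / M`, together with an interval `(a', c')` of length at least `(c - a) / M` in its base which
is the base of a return tower of height `r` over `(a, c)`. -/
structure IsNestedTower (f : Ico (0 : ℝ) b → Ico (0 : ℝ) b) (M : ℕ) (ε a c : ℝ) (h : ℕ)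
    (a' c' : ℝ) (r : ℕ) : Prop where
  nonneg : 0 ≤ a
  lt : a < c
  le_b : c ≤ b
  small : c - a < ε
  large : b ≤ M * (h * (c - a))
  translatesOn : ∀ k < h, ∃ τ, TranslatesOn f^[k] a c τ
  notMem : ∀ k, 0 < k → k < h → ∀ x ∈ seg b a c, f^[k] x ∉ seg b a c
  isReturnTower : IsReturnTower f a c a' c' r
  long : c - a ≤ M * (c' - a')

theorem IsIET.exists_isNestedTower (hb : 0 < b) (hf : IsIET f) (herg : Ergodic f (lebesgueIco b))
    {ε : ℝ} (hε : 0 < ε) : ∃ a c h a' c' r,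
      IsNestedTower f ({x | ¬ ContinuousAt f x}.ncard + 3) ε a c h a' c' r := by
  obtain ⟨v, hv0, hv⟩ := exists_between (lt_min hε hb)
  have hvε := hv.trans_le (min_le_left _ _)
  have hvb := hv.trans_le (min_le_right _ _)
  obtain ⟨a, c, h, htow, hlarge⟩ := hf.exists_large_returnTower herg le_rfl hv0 hvb.le
  have hcb := htow.le_right.trans hvb.le
  obtain ⟨a', c', r, htow', hlong⟩ :=
    hf.exists_long_returnTower herg.toMeasurePreserving htow.left_le htow.lt hcb
  have h1 := htow.left_le
  have h2 := htow.le_right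
  exact ⟨a, c, h, a', c', r, h1, htow.lt, hcb, by linarith, hlarge,
    fun k hk => htow.translatesOn k hk.le,
    fun k hk hkh x hx hxk => htow.notMem k hk hkh x hx (seg_subset_seg h1 h2 hxk),
    htow', hlong⟩

/-- The levels in the upper half of the tower of height `h`, over the middle third of `(a', c')`. -/
def middleLevels (f : Ico (0 : ℝ) b → Ico (0 : ℝ) b) (h : ℕ) (a' c' : ℝ) :
    Set (Ico (0 : ℝ) b) :=
  ⋃ k ∈ Finset.Ico (h / 2) h, f^[k] '' seg b (a' + (c' - a') / 3) (c' - (c' - a') / 3)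

theorem mem_middleLevels {h : ℕ} {a' c' : ℝ} {x : Ico (0 : ℝ) b} :
    x ∈ middleLevels f h a' c' ↔ ∃ k, h / 2 ≤ k ∧ k < h ∧
      ∃ y ∈ seg b (a' + (c' - a') / 3) (c' - (c' - a') / 3), f^[k] y = x := by
  simp [middleLevels, and_assoc]

/-- A lower bound for the measure of a third of a return tower, in its lower or upper half. -/
noncomputable def splitMass (b : ℝ) (M : ℕ) : ENNReal := ENNReal.ofReal (b / (6 * M ^ 2))

namespace IsNestedTower

variable {M : ℕ} {ε a c : ℝ} {h : ℕ} {a' c' : ℝ} {r : ℕ}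

theorem iterate_ne (H : IsNestedTower f M ε a c h a' c' r) (hf : Function.Injective f)
    {i j : ℕ} (hi : i < h) (hj : j < h) (hij : i ≠ j) {x y : Ico (0 : ℝ) b}
    (hx : x ∈ seg b a c) (hy : y ∈ seg b a c) : f^[i] x ≠ f^[j] y := by
  have key : ∀ i j, j < h → i < j → ∀ x ∈ seg b a c, ∀ y ∈ seg b a c, f^[i] x ≠ f^[j] y := by
    intro i j hj hij x hx y hy hxy
    obtain ⟨k, rfl⟩ := Nat.exists_eq_add_of_lt hij
    rw [add_assoc, Function.iterate_add_apply] at hxy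
    exact H.notMem (k + 1) (by omega) (by omega) y hy (hf.iterate _ hxy ▸ hx)
  rcases lt_or_gt_of_ne hij with hlt | hlt
  · exact key i j hj hlt x hx y hy
  · exact (key j i hi hlt y hy x hx).symm

theorem image_level (H : IsNestedTower f M ε a c h a' c' r) {k : ℕ} (hk : k < h) {p q : ℝ}
    (hp : a ≤ p) (hpq : p < q) (hq : q ≤ c) : IsOpen (f^[k] '' seg b p q) ∧
      lebesgueIco b (f^[k] '' seg b p q) = ENNReal.ofReal (q - p) := by
  obtain ⟨τ, hτ⟩ := H.translatesOn k hk
  have hτ' := hτ.mono hp hq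
  have hp0 := H.nonneg.trans hp
  have hqb := hq.trans H.le_b
  obtain ⟨h0, h1⟩ := hτ'.bounds hp0 hpq hqb
  rw [hτ'.image_seg hp0 hqb, lebesgueIco_seg h0 h1]
  exact ⟨isOpen_seg, by congr 1; ring⟩

theorem lebesgueIco_levels (H : IsNestedTower f M ε a c h a' c' r) (hf : Function.Injective f)
    {s : Finset ℕ} (hs : ∀ k ∈ s, k < h) {p q : ℝ} (hp : a ≤ p) (hpq : p < q) (hq : q ≤ c) :
    lebesgueIco b (⋃ k ∈ s, f^[k] '' seg b p q) = ENNReal.ofReal (s.card * (q - p)) := by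
  rw [measure_biUnion_finset]
  · rw [Finset.sum_congr rfl fun k hk => (H.image_level (hs k hk) hp hpq hq).2, Finset.sum_const,
      nsmul_eq_mul, ENNReal.ofReal_mul (Nat.cast_nonneg _), ENNReal.ofReal_natCast]
  · intro i hi j hj hij
    refine disjoint_left.2 ?_
    rintro _ ⟨x, hx, rfl⟩ ⟨y, hy, hxy⟩
    exact H.iterate_ne hf (hs i hi) (hs j hj) hij (seg_subset_seg hp hq hx)
      (seg_subset_seg hp hq hy) hxy.symm
  · exact fun k hk => (H.image_level (hs k hk) hp hpq hq).1.measurableSet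

/-- At least half of the levels over at least a third of `(a', c')` have measure at least
`splitMass b M`. -/
theorem splitMass_le (H : IsNestedTower f M ε a c h a' c' r) {n : ℕ}
    (hn : h ≤ 2 * n) {w : ℝ} (hw : (c' - a') / 3 ≤ w) :
    splitMass b M ≤ ENNReal.ofReal (n * w) := by
  refine ENNReal.ofReal_le_ofReal ?_
  have hac : 0 < c - a := sub_pos.2 H.lt
  have hM : (0 : ℝ) < M := by
    rcases Nat.eq_zero_or_pos M with rfl | h0
    · have := H.long
      simp only [Nat.cast_zero, zero_mul] at this
      linarith
    · exact_mod_cast h0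
  have hn' : (h : ℝ) ≤ 2 * n := by exact_mod_cast hn
  rw [div_le_iff₀ (by positivity)]
  have hw0 : 0 < w := lt_of_lt_of_le (by linarith [H.isReturnTower.lt]) hw
  calc b ≤ M * (h * (c - a)) := H.large
    _ ≤ M * (2 * n * (M * (3 * w))) := by
      gcongr
      exact H.long.trans (by gcongr; linarith)
    _ = n * w * (6 * M ^ 2) := by ring

theorem isOpen_middleLevels (H : IsNestedTower f M ε a c h a' c' r) :
    IsOpen (middleLevels f h a' c') := by
  have h1 := H.isReturnTower.left_le
  have h2 := H.isReturnTower.le_right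
  have h3 := H.isReturnTower.lt
  exact isOpen_biUnion fun k hk => (H.image_level (Finset.mem_Ico.1 hk).2 (by linarith)
    (by linarith) (by linarith)).1

theorem splitMass_le_middleLevels (H : IsNestedTower f M ε a c h a' c' r)
    (hf : Function.Injective f) : splitMass b M ≤ lebesgueIco b (middleLevels f h a' c') := by
  have h1 := H.isReturnTower.left_le
  have h2 := H.isReturnTower.le_right
  have h3 := H.isReturnTower.lt
  rw [middleLevels, H.lebesgueIco_levels hf (fun k hk => (Finset.mem_Ico.1 hk).2) (by linarith)
    (by linarith) (by linarith), Nat.card_Ico]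
  exact H.splitMass_le (by omega) (by linarith)

/-- Only the top level of the tower leaves `middleLevels` under `f`. -/
theorem lebesgueIco_middleLevels_diff_le (H : IsNestedTower f M ε a c h a' c' r) :
    lebesgueIco b (middleLevels f h a' c' \ f ⁻¹' middleLevels f h a' c') ≤
      ENNReal.ofReal ε := by
  have h1 := H.isReturnTower.left_le
  have h2 := H.isReturnTower.le_right
  have h3 := H.isReturnTower.lt
  rcases Nat.eq_zero_or_pos h with rfl | h0
  · simp [middleLevels]
  refine le_trans (measure_mono (t := f^[h - 1] '' seg b a c) ?_) ?_
  · rintro x ⟨hx, hfx⟩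
    obtain ⟨k, hk1, hk2, y, hy, rfl⟩ := mem_middleLevels.1 hx
    rcases Nat.lt_or_ge (k + 1) h with hk | hk
    · exact absurd (mem_middleLevels.2 ⟨k + 1, by omega, hk, y, hy,
        Function.iterate_succ_apply' f k y⟩) hfx
    · obtain rfl : k = h - 1 := by omega
      exact ⟨y, seg_subset_seg (by linarith) (by linarith) hy, rfl⟩
  · rw [(H.image_level (by omega) le_rfl H.lt le_rfl).2]
    exact ENNReal.ofReal_le_ofReal H.small.le

theorem height_le (H : IsNestedTower f M ε a c h a' c' r) : h ≤ r := by
  by_contra! hlt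
  have hR := H.isReturnTower
  obtain ⟨x, hx⟩ := seg_nonempty (H.nonneg.trans hR.left_le) hR.lt (hR.le_right.trans H.le_b)
  exact H.notMem r hR.pos hlt x (seg_subset_seg hR.left_le hR.le_right hx) (hR.mapsTo hx)

/-- Let `t` lie in `middleLevels`, say in level `k` of the tower. Up to level `k`, the return to
`(a, c)` at time `r` does not change the position relative to `t`, so all points of the lower half
of the tower over the left third of `(a', c')` visit `[0, t)` equally often before time `r`, and
exactly once more than those over the right third. -/
theorem hasSplitReturns (H : IsNestedTower f M ε a c h a' c' r) (hf : Function.Injective f)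
    {t : Ico (0 : ℝ) b} (ht : t ∈ middleLevels f h a' c') :
    HasSplitReturns f (lebesgueIco b) (initialInterval t) (splitMass b M) ε := by
  classical
  have hR := H.isReturnTower
  have h1 := hR.left_le
  have h2 := hR.le_right
  have h3 := hR.lt
  have hrh := H.height_le
  obtain ⟨k, hk1, hk2, x₀, hx₀, rfl⟩ := mem_middleLevels.1 ht
  set t := f^[k] x₀ with ht_def
  set w := (c' - a') / 3 with hw
  have hx₀' : x₀ ∈ seg b a' c' := seg_subset_seg (by linarith) (by linarith) hx₀
  have hsub : seg b a' c' ⊆ seg b a c := seg_subset_seg h1 h2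
  set χ : Ico (0 : ℝ) b → ℕ := (initialInterval t).indicator 1 with hχ
  have hχ_apply : ∀ y, χ y = if (y : ℝ) < t then 1 else 0 := by
    intro y
    rw [hχ, indicator_apply]
    rfl
  -- the levels `m ≠ k` of the tower over `(a', c')` do not contain `t`
  have hlevel : ∀ m < r, m ≠ k → ∀ x ∈ seg b a' c', f^[m] x ≠ t := by
    intro m hm hmk x hx hxt
    rcases lt_or_gt_of_ne hmk with hlt | hlt
    · obtain ⟨j, rfl⟩ := Nat.exists_eq_add_of_lt hlt
      rw [ht_def, add_assoc, Function.iterate_add_apply] at hxt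
      exact H.notMem (j + 1) (by omega) (by omega) x₀ (hsub hx₀')
        (hf.iterate _ hxt ▸ hsub hx)
    · obtain ⟨j, rfl⟩ := Nat.exists_eq_add_of_lt hlt
      rw [ht_def, add_assoc, Function.iterate_add_apply] at hxt
      exact hR.notMem (j + 1) (by omega) (by omega) x hx
        ((hf.iterate _ hxt).symm ▸ hsub hx₀')
  have hconst : ∀ m < r, m ≠ k → ∀ x ∈ seg b a' c', χ (f^[m] x) = χ (f^[m] x₀) := by
    intro m hm hmk x hx
    obtain ⟨τ, hτ⟩ := hR.translatesOn m hm.le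
    have hiff := hτ.lt_iff_lt (t := t)
      (by rintro ⟨y, hy, hyt⟩; exact hlevel m hm hmk y hy hyt) hx hx₀'
    simp only [hχ_apply, hiff]
  set N := ∑ m ∈ (Finset.range r).erase k, χ (f^[m] x₀) with hN
  have hvisit : ∀ x ∈ seg b a' c', birkhoffSum f χ r x = χ (f^[k] x) + N := by
    intro x hx
    rw [birkhoffSum, ← Finset.add_sum_erase _ _ (Finset.mem_range.2 (hk2.trans_le hrh)), hN]
    congr 1
    refine Finset.sum_congr rfl fun m hm => ?_
    rw [Finset.mem_erase, Finset.mem_range] at hm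
    exact hconst m hm.2 hm.1 x hx
  -- starting in the lower half of the tower does not change the number of visits
  have hshift : ∀ l ≤ k, ∀ x ∈ seg b a' c',
      birkhoffSum f χ r (f^[l] x) = birkhoffSum f χ r x := by
    intro l hl x hx
    have heq : birkhoffSum f χ l (f^[r] x) = birkhoffSum f χ l x := by
      refine Finset.sum_congr rfl fun m hm => ?_
      rw [Finset.mem_range] at hm
      obtain ⟨τ, hτ⟩ := H.translatesOn m (by omega)
      have hiff := hτ.lt_iff_lt (t := t) (by
        rintro ⟨y, hy, hyt⟩
        exact H.iterate_ne hf (by omega) hk2 (by omega) hy (hsub hx₀') hyt)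
        (hR.mapsTo hx) (hsub hx)
      simp only [hχ_apply, hiff]
    have e1 := birkhoffSum_add f χ l r x
    have e2 := birkhoffSum_add f χ r l x
    rw [add_comm r l, heq] at e2
    omega
  have hclose : ∀ l < h, ∀ x ∈ seg b a' c', dist (f^[r] (f^[l] x)) (f^[l] x) < ε := by
    intro l hl x hx
    obtain ⟨τ, hτ⟩ := H.translatesOn l hl
    have hrx := hR.mapsTo hx
    have hx' := hsub hx
    rw [← Function.iterate_add_apply, add_comm, Function.iterate_add_apply, Subtype.dist_eq,
      hτ _ hrx, hτ _ hx', Real.dist_eq, add_sub_add_right_eq_sub, abs_lt]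
    rw [mem_seg] at hrx hx'
    constructor <;> linarith [H.small, hrx.1, hrx.2, hx'.1, hx'.2]
  obtain ⟨σ, hσ⟩ := H.translatesOn k hk2
  have hcompare : ∀ x ∈ seg b a' c', ((f^[k] x : ℝ) < t ↔ (x : ℝ) < x₀) := by
    intro x hx
    rw [ht_def, hσ x (hsub hx), hσ x₀ (hsub hx₀')]
    exact add_lt_add_iff_right σ
  have hlow : ∀ l ∈ Finset.range (h / 2 + 1), l ≤ k ∧ l < h := by
    intro l hl
    rw [Finset.mem_range] at hl
    omega
  have hmass : ∀ p, a ≤ p → p + w ≤ c → splitMass b M ≤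
      lebesgueIco b (⋃ l ∈ Finset.range (h / 2 + 1), f^[l] '' seg b p (p + w)) := by
    intro p hp hpc
    rw [H.lebesgueIco_levels hf (fun l hl => (hlow l hl).2) hp (by linarith) hpc,
      Finset.card_range]
    exact H.splitMass_le (by omega) (by linarith)
  have hmem : ∀ p y, a' ≤ p → p + w ≤ c' →
      y ∈ ⋃ l ∈ Finset.range (h / 2 + 1), f^[l] '' seg b p (p + w) →
      ∃ l ≤ k, l < h ∧ ∃ x ∈ seg b a' c', x ∈ seg b p (p + w) ∧ f^[l] x = y := by
    intro p y hp hpc hy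
    obtain ⟨l, hl, x, hx, rfl⟩ := mem_iUnion₂.1 hy
    exact ⟨l, (hlow l hl).1, (hlow l hl).2, x, seg_subset_seg hp hpc hx, hx, rfl⟩
  refine ⟨r, N, _, _, hmass a' h1 (by linarith), hmass (c' - w) (by linarith) (by linarith),
    ?_, ?_, ?_⟩
  · rintro y (hy | hy)
    · obtain ⟨l, -, hl, x, hx, -, rfl⟩ := hmem _ y le_rfl (by linarith) hy
      exact hclose l hl x hx
    · obtain ⟨l, -, hl, x, hx, -, rfl⟩ := hmem _ y (by linarith) (by linarith) hy
      exact hclose l hl x hx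
  · intro y hy
    obtain ⟨l, hl, -, x, hx, hxp, rfl⟩ := hmem _ y le_rfl (by linarith) hy
    rw [hshift l hl x hx, hvisit x hx, hχ_apply,
      if_pos ((hcompare x hx).2 (hxp.2.trans hx₀.1)), add_comm]
  · intro y hy
    obtain ⟨l, hl, -, x, hx, hxp, rfl⟩ := hmem _ y (by linarith) (by linarith) hy
    rw [hshift l hl x hx, hvisit x hx, hχ_apply,
      if_neg (fun hlt => lt_asymm ((hcompare x hx).1 hlt) (hx₀.2.trans hxp.1)), zero_add]

theorem pos_of_mem_middleLevels (H : IsNestedTower f M ε a c h a' c' r) {t : Ico (0 : ℝ) b}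
    (ht : t ∈ middleLevels f h a' c') : 0 < (t : ℝ) := by
  have hR := H.isReturnTower
  have h1 := hR.left_le
  have h2 := hR.le_right
  have h3 := hR.lt
  obtain ⟨k, -, hk, x, hx, rfl⟩ := mem_middleLevels.1 ht
  obtain ⟨τ, hτ⟩ := H.translatesOn k hk
  have hx' : x ∈ seg b a c := seg_subset_seg (by linarith) (by linarith) hx
  have := (hτ.bounds H.nonneg H.lt H.le_b).1
  rw [hτ x hx']
  linarith [hx'.1]

end IsNestedTower

end NestedTowers

/-! ### Typical induced maps -/

theorem measure_le_limsup {α : Type*} [MeasurableSpace α] {μ : Measure α} [IsFiniteMeasure μ]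
    {s : ℕ → Set α} (hs : ∀ n, MeasurableSet (s n)) {κ : ENNReal} (hκ : ∀ n, κ ≤ μ (s n)) :
    κ ≤ μ (⋂ n, ⋃ i ≥ n, s i) := by
  have hanti : Antitone fun n => ⋃ i ≥ n, s i := fun m n hmn =>
    iUnion₂_mono' fun i hi => ⟨i, le_trans hmn hi, Subset.rfl⟩
  refine ge_of_tendsto' (tendsto_measure_iInter_atTop (μ := μ)
    (fun n => (MeasurableSet.biUnion (to_countable _) fun i _ => hs i).nullMeasurableSet) hanti
    ⟨0, measure_ne_top _ _⟩) fun n => (hκ n).trans ?_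
  exact measure_mono (subset_biUnion_of_mem (u := s) (le_refl n))

/-- By Borel–Cantelli, the upper limit of a sequence of sets is almost invariant if the parts which
leave these sets have summable measures. -/
theorem measure_compl_limsup_eq_zero {α : Type*} [MeasurableSpace α] {μ : Measure α} [IsFiniteMeasure μ]
    {f : α → α} (hf : Ergodic f μ) {s : ℕ → Set α} (hs : ∀ n, MeasurableSet (s n)) {κ : ENNReal}
    (hκ0 : 0 < κ) (hκ : ∀ n, κ ≤ μ (s n)) (hsum : ∑' n, μ (s n \ f ⁻¹' s n) ≠ ⊤) :
    μ (⋂ n, ⋃ i ≥ n, s i)ᶜ = 0 := by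
  have hm : MeasurableSet (⋂ n, ⋃ i ≥ n, s i) := MeasurableSet.iInter fun n =>
    MeasurableSet.biUnion (to_countable _) fun i _ => hs i
  have hinv : (⋂ n, ⋃ i ≥ n, s i : Set α) ≤ᵐ[μ] f ⁻¹' (⋂ n, ⋃ i ≥ n, s i) := by
    filter_upwards [ae_eventually_notMem hsum] with x hx hxs
    obtain ⟨n₀, hn₀⟩ := eventually_atTop.1 hx
    refine mem_iInter.2 fun n => ?_
    obtain ⟨i, hi, hxi⟩ := mem_iUnion₂.1 (mem_iInter.1 hxs (max n n₀))
    refine mem_iUnion₂.2 ⟨i, (le_max_left _ _).trans hi, ?_⟩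
    by_contra hfx
    exact hn₀ i ((le_max_right _ _).trans hi) ⟨hxi, hfx⟩
  rcases hf.ae_empty_or_univ_of_ae_le_preimage hm.nullMeasurableSet hinv with h | h
  · have := measure_le_limsup hs hκ
    rw [ae_eq_empty.1 h] at this
    exact absurd this (not_le.2 hκ0)
  · exact ae_eq_univ.1 h

theorem HasSplitReturns.mono {X : Type*} [MeasurableSpace X] [MetricSpace X] {f : X → X}
    {μ : Measure X} {A : Set X} {κ : ENNReal} {ε ε' : ℝ} (h : HasSplitReturns f μ A κ ε)
    (hε : ε ≤ ε') : HasSplitReturns f μ A κ ε' := by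
  obtain ⟨r, N, B, B', h1, h2, h3, h4⟩ := h
  exact ⟨r, N, B, B', h1, h2, fun y hy => (h3 y hy).trans_le hε, h4⟩

theorem dense_of_lebesgueIco_compl_eq_zero {b : ℝ} {s : Set (Ico (0 : ℝ) b)}
    (hs : lebesgueIco b sᶜ = 0) : Dense s := by
  rw [← compl_compl s, ← interior_eq_empty_iff_dense_compl, eq_empty_iff_forall_notMem]
  intro x hx
  obtain ⟨δ, hδ, hball⟩ := Metric.isOpen_iff.1 isOpen_interior x hx
  have hxb := x.2.2
  have hlt : (x : ℝ) < min b (x + δ) := lt_min hxb (by linarith)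
  have hseg : seg b x (min b (x + δ)) ⊆ sᶜ := by
    intro y hy
    refine interior_subset (hball ?_)
    have := hy.2.trans_le (min_le_right _ _)
    rw [Metric.mem_ball, Subtype.dist_eq, Real.dist_eq, abs_lt]
    constructor <;> linarith [hy.1]
  have h0 := measure_mono_null hseg hs
  rw [lebesgueIco_seg x.2.1 (min_le_left _ _), ENNReal.ofReal_eq_zero] at h0
  linarith

theorem measurableSet_initialInterval {b : ℝ} (t : Ico (0 : ℝ) b) :
    MeasurableSet (initialInterval t) :=
  measurableSet_lt measurable_subtype_coe measurable_const

theorem theorem1 {b : ℝ} (hb : 0 < b) (f : Ico (0 : ℝ) b → Ico (0 : ℝ) b) (hf : IsIET f)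
    (herg : Ergodic f (lebesgueIco b)) :
    weakMixingSet f ∈ residual (Ico (0 : ℝ) b) ∧
      lebesgueIco b (weakMixingSet f)ᶜ = 0 ∧
      lebesgueIco b (weakMixingSet f) = ENNReal.ofReal b := by
  set M := {x | ¬ ContinuousAt f x}.ncard + 3 with hM
  have hκ0 : 0 < splitMass b M := by
    have : (0 : ℝ) < M := by positivity
    exact ENNReal.ofReal_pos.2 (by positivity)
  choose a c h a' c' r H using fun n : ℕ =>
    hf.exists_isNestedTower hb herg (ε := (1 / 2) ^ n) (by positivity)
  set E : ℕ → Set (Ico (0 : ℝ) b) := fun n => middleLevels f (h n) (a' n) (c' n) with hE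
  have hopen : ∀ n, IsOpen (E n) := fun n => (H n).isOpen_middleLevels
  have hfull : lebesgueIco b (⋂ n, ⋃ i ≥ n, E i)ᶜ = 0 := by
    refine measure_compl_limsup_eq_zero herg (fun n => (hopen n).measurableSet) hκ0
      (fun n => (H n).splitMass_le_middleLevels hf.bijective.injective) ?_
    refine ne_top_of_le_ne_top ?_
      (ENNReal.tsum_le_tsum fun n => (H n).lebesgueIco_middleLevels_diff_le)
    rw [← ENNReal.ofReal_tsum_of_nonneg (fun n => by positivity) summable_geometric_two]
    exact ENNReal.ofReal_ne_top
  have hsub : ⋂ n, ⋃ i ≥ n, E i ⊆ weakMixingSet f := by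
    intro t ht
    have hmem : ∀ n, ∃ i ≥ n, t ∈ E i := fun n => by
      simpa using mem_iInter.1 ht n
    obtain ⟨i, -, hi⟩ := hmem 0
    refine ⟨(H i).pos_of_mem_middleLevels hi, weaklyMixing_inducedMap_of_hasSplitReturns herg
      (measurableSet_initialInterval t) hκ0 fun ε hε => ?_⟩
    obtain ⟨n, hn⟩ := exists_pow_lt_of_lt_one hε (by norm_num : (1 / 2 : ℝ) < 1)
    obtain ⟨i, hin, hi⟩ := hmem n
    refine ((H i).hasSplitReturns hf.bijective.injective hi).mono ?_
    exact (pow_le_pow_of_le_one (by norm_num) (by norm_num) hin).trans hn.le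
  have hnull : lebesgueIco b (weakMixingSet f)ᶜ = 0 :=
    measure_mono_null (compl_subset_compl.2 hsub) hfull
  refine ⟨?_, hnull, ?_⟩
  · refine mem_of_superset (countable_iInter_mem.2 fun n => ?_) hsub
    refine residual_of_dense_open (isOpen_biUnion fun i _ => hopen i) ?_
    exact dense_of_lebesgueIco_compl_eq_zero
      (measure_mono_null (compl_subset_compl.2 (iInter_subset _ n)) hfull)
  · rw [measure_congr (ae_eq_univ.2 hnull), lebesgueIco_univ]
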